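/- Let $\mathcal K$ be a commutative (entropic) variety of finitary algebras, that is, one in which every operation $\sigma_K:K^n\to K$ of every algebra $K$ is a homomorphism. For algebras $A,B$ let $[A,B]$ be the algebra of all homomorphisms $A\to B$ with pointwise operations; $\mathcal K$ is enriched over itself by these hom-objects (it is symmetric monoidal closed for the tensor product that represents bimorphisms). Let $D$ be an algebra, write $X^{\ast}=[X,D]$, and let $(-)^{\ast\ast}$ be the double-dualization monad, with unit $\eta_X:X\to X^{\ast\ast}$ given by evaluation. Let $E:\mathcal K_{fp}\hookrightarrow\mathcal K$ be the full embedding of the finitely presentable algebras. Assume that $D$ is a $\ast$-cogenerator: $D$ is a cogenerator of $\mathcal K$ and, for every algebra $X$, the morphisms $a^{\ast}:A^{\ast}\to X^{\ast}$, for all $a:X\to A$ with $A$ finitely presentable, form a colimit cocone of the diagram $(X/\mathcal K_{fp})^{\mathrm{op}}\to\mathcal K$, $(A,a)\mapsto A^{\ast}$. Let $\mathbb T$ be the $D$-ultrafilter monad, that is, the submonad of $(-)^{\ast\ast}$ for which $TX\subseteq X^{\ast\ast}$ is the intersection, over all $a:X\to A$ with $A$ finitely presentable, of the preimages of $\eta_A:A\rightarrowtail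 A^{\ast\ast}$ under $a^{\ast\ast}:X^{\ast\ast}\to A^{\ast\ast}$. Then $\mathbb T$ is the $\mathcal K$-enriched codensity monad of $E$ (the enriched right Kan extension of $E$ along itself with its canonical monad structure). Explicitly: for algebras $X,Z$ let $N(X,Z)$ be the algebra of enriched natural transformations $[X,E-]\to[Z,E-]$, i.e. the equalizer of $$u,v:\prod_{A\in\mathcal K_{fp}}[[X,A],[Z,A]]\rightrightarrows\prod_{B,C\in\mathcal K_{fp}}\big[[B,C],[[X,B],[Z,C]]\big],\qquad u(\tau)_{B,C}(f)=[Z,f]\cdot\tau_B,\quad v(\tau)_{B,C}(f)=\tau_C\cdot[X,f].$$ Then $T$ is an enriched functor, and there are isomorphisms of algebras $$\lambda_{X,Z}:[Z,TX]\cong N(X,Z),$$ natural in $Z$ and in $X$, such that, with $\psi_a=\lambda_{X,TX}(\mathrm{id}_{TX})_A(a):TX\to A$ for $a:X\to A$ with $A$ finitely presentable, the unit $\eta^T$ and the multiplication $\mu^T$ of $\mathbb T$ are those of the codensity monad: $\lambda_{X,X}(\eta^T_X)_A(a)=a$ and $\lambda_{X,TTX}(\mu^T_X)_A(a)=\psi_{\psi_a}$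 (equivalently, $\psi_a\cdot\eta^T_X=a$ and $\psi_a\cdot\mu^T_X=\psi_{\psi_a}$). -/

import Mathlib

open CategoryTheory CategoryTheory.Limits Opposite
open scoped FirstOrder

universe u v v' v'' w w'

noncomputable section

namespace EntropicVariety

/-! ### Varieties of finitary algebras -/

/-- An equational presentation of a variety of finitary algebras: a signature of finitary operation
symbols (a first-order language without relation symbols) and a set of equations between terms. -/
structure Variety where
  /-- the signature; `sig.Functions n` is the set of `n`-ary operation symbols -/
  sig : FirstOrder.Language.{u, u}
  [isAlgebraic : sig.IsAlgebraic]
  /-- the equations (pairs of terms in countably many variables) -/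
  equations : Set (sig.Term ℕ × sig.Term ℕ)

attribute [instance] Variety.isAlgebraic

/-- The structure `M` satisfies all equations of the variety. -/
def Variety.Satisfies (V : Variety.{u}) (M : Type v) [V.sig.Structure M] : Prop :=
  ∀ e ∈ V.equations, ∀ x : ℕ → M, e.1.realize x = e.2.realize x

/-- The algebras of the variety `V`, with carriers in `Type v`. -/
structure Variety.Alg (V : Variety.{u}) where
  /-- the underlying set -/
  carrier : Type v
  [str : V.sig.Structure carrier]
  sat : V.Satisfies carrier

variable {V : Variety.{u}}

instance : CoeSort (Variety.Alg.{u, v} V) (Type v) := ⟨Variety.Alg.carrier⟩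

instance (A : Variety.Alg.{u, v} V) : V.sig.Structure A := A.str

/-- The operation of an algebra given by an operation symbol. -/
abbrev oper (A : Variety.Alg.{u, v} V) {n : ℕ} (σ : V.sig.Functions n) (a : Fin n → A) : A :=
  FirstOrder.Language.Structure.funMap σ a

/-- The category of algebras of `V` and homomorphisms. -/
instance : Category.{v} (Variety.Alg.{u, v} V) where
  Hom A B := A →[V.sig] B
  id A := FirstOrder.Language.Hom.id V.sig A
  comp f g := FirstOrder.Language.Hom.comp g f

instance (A B : Variety.Alg.{u, v} V) : FunLike (A ⟶ B) A B :=
  inferInstanceAs (FunLike (A →[V.sig] B) A B)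

/-- A function that preserves all operations, as a homomorphism. -/
def mkHom {A : Variety.Alg.{u, v} V} {B : Variety.Alg.{u, w} V} (f : A → B)
    (hf : ∀ {n : ℕ} (σ : V.sig.Functions n) (a : Fin n → A),
      f (oper A σ a) = oper B σ (fun i => f (a i))) : A →[V.sig] B where
  toFun := f
  map_fun' σ a := hf σ a
  map_rel' r := isEmptyElim r

@[simp] theorem mkHom_apply {A : Variety.Alg.{u, v} V} {B : Variety.Alg.{u, w} V} (f : A → B)
    (hf) (a : A) : (mkHom f hf : A →[V.sig] B) a = f a := rfl

@[simp] theorem id_apply (A : Variety.Alg.{u, v} V) (a : A) : (𝟙 A : A ⟶ A) a = a := rfl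

@[simp] theorem comp_apply {A B C : Variety.Alg.{u, v} V} (f : A ⟶ B) (g : B ⟶ C) (a : A) :
    (f ≫ g) a = g (f a) := rfl

theorem hom_op {A B : Variety.Alg.{u, v} V} (f : A ⟶ B) {n : ℕ} (σ : V.sig.Functions n)
    (a : Fin n → A) : f (oper A σ a) = oper B σ (fun i => f (a i)) :=
  FirstOrder.Language.Hom.map_fun f σ a

@[ext] theorem hom_ext {A B : Variety.Alg.{u, v} V} {f g : A ⟶ B} (h : ∀ a, f a = g a) : f = g :=
  DFunLike.ext f g h

/-- A structure with a jointly injective family of homomorphisms into algebras of `V` is an algebra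
of `V`. -/
theorem satisfies_of_jointly_injective {M : Type v} [V.sig.Structure M] {ι : Type w}
    (F : ι → Variety.Alg.{u, w'} V) (p : ∀ i, M →[V.sig] F i)
    (hp : ∀ x y : M, (∀ i, p i x = p i y) → x = y) : V.Satisfies M := by
  intro e he x
  refine hp _ _ fun i => ?_
  rw [← FirstOrder.Language.HomClass.realize_term, ← FirstOrder.Language.HomClass.realize_term]
  exact (F i).sat e he _

/-- The product of a family of algebras, with pointwise operations. -/
def pi {ι : Type w} (F : ι → Variety.Alg.{u, v} V) : Variety.Alg.{u, max w v} V :=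
  letI : V.sig.Structure (∀ i, F i) :=
    { funMap := fun σ x i => oper (F i) σ (fun k => x k i) }
  { carrier := ∀ i, F i
    sat := satisfies_of_jointly_injective F
      (fun i =>
        { toFun := fun x => x i
          map_fun' := fun _ _ => rfl
          map_rel' := fun r => isEmptyElim r })
      (fun _ _ h => funext h) }

/-- The projections of a product. -/
def proj {ι : Type w} (F : ι → Variety.Alg.{u, v} V) (i : ι) : pi F →[V.sig] F i :=
  mkHom (fun x => x i) (fun _ _ => rfl)

/-- A subalgebra, as an algebra. -/
def ofSub {A : Variety.Alg.{u, v} V} (S : V.sig.Substructure A) : Variety.Alg.{u, v} V where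
  carrier := S
  sat := satisfies_of_jointly_injective (fun _ : Unit => A) (fun _ => S.subtype.toHom)
    (fun _ _ h => Subtype.ext (h ()))

/-- The inclusion of a subalgebra. -/
def subIncl {A : Variety.Alg.{u, v} V} (S : V.sig.Substructure A) : ofSub S ⟶ A :=
  mkHom (A := ofSub S) (B := A) (fun x => x.1) (fun _ _ => rfl)

/-! ### Commutative varieties, hom-objects and bimorphisms -/

/-- The variety is commutative (entropic): every operation of every algebra `K` is a homomorphism
`K ^ n → K`, where `K ^ n` has the pointwise operations. -/
class Variety.IsCommutative (V : Variety.{u}) : Prop where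
  comm : ∀ (K : Variety.Alg.{u, u} V) {n : ℕ} (σ : V.sig.Functions n) {m : ℕ}
    (ρ : V.sig.Functions m) (x : Fin m → Fin n → K),
    oper K σ (fun i => oper K ρ (fun j => x j i)) = oper K ρ (fun j => oper K σ (x j))

/-- Bimorphisms `A × B → C`: functions which are homomorphisms in each variable separately. These
are the maps which the tensor product `A ⊗ B` represents. -/
structure Bimorphism (A : Variety.Alg.{u, v} V) (B : Variety.Alg.{u, w} V)
    (C : Variety.Alg.{u, w'} V) where
  /-- the underlying function -/
  toFun : A → B → C
  map_left : ∀ {n : ℕ} (σ : V.sig.Functions n) (a : Fin n → A) (b : B),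
    toFun (oper A σ a) b = oper C σ (fun i => toFun (a i) b)
  map_right : ∀ {n : ℕ} (σ : V.sig.Functions n) (a : A) (b : Fin n → B),
    toFun a (oper B σ b) = oper C σ (fun i => toFun a (b i))

namespace Bimorphism

/-- Composition with the symmetry of the tensor product. -/
def flip {A : Variety.Alg.{u, v} V} {B : Variety.Alg.{u, w} V} {C : Variety.Alg.{u, w'} V}
    (β : Bimorphism A B C) : Bimorphism B A C where
  toFun b a := β.toFun a b
  map_left σ b a := β.map_right σ a b
  map_right σ b a := β.map_left σ a b

/-- Precomposition of a bimorphism with the tensor product `f ⊗ g` of two homomorphisms. -/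
def precomp {A : Variety.Alg.{u, v} V} {B : Variety.Alg.{u, w} V} {C : Variety.Alg.{u, w'} V}
    {A' : Variety.Alg.{u, v'} V} {B' : Variety.Alg.{u, v''} V} (β : Bimorphism A B C)
    (f : A' →[V.sig] A) (g : B' →[V.sig] B) : Bimorphism A' B' C where
  toFun a b := β.toFun (f a) (g b)
  map_left σ a b := by
    rw [← β.map_left]; exact congrArg (β.toFun · (g b)) (f.map_fun σ a)
  map_right σ a b := by
    rw [← β.map_right]; exact congrArg (β.toFun (f a)) (g.map_fun σ b)

end Bimorphism

variable [V.IsCommutative]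

/-- The hom-object `[A, B]`: the algebra of all homomorphisms from `A` to `B` with pointwise
operations. With the tensor product representing bimorphisms, these are the hom-objects of the
closed monoidal structure, see `curryEquiv`. -/
def ihom (A B : Variety.Alg.{u, u} V) : Variety.Alg.{u, u} V :=
  letI : V.sig.Structure (A ⟶ B) :=
    { funMap := fun {n} σ f => mkHom (fun a => oper B σ (fun i => f i a)) (by
        intro m ρ a
        rw [← Variety.IsCommutative.comm B σ ρ (fun j i => f i (a j))]
        congr 1
        funext i
        exact hom_op (f i) ρ a) }
  { carrier := A ⟶ B
    sat := satisfies_of_jointly_injective (fun _ : A => B)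
      (fun a =>
        { toFun := fun f => f a
          map_fun' := fun _ _ => rfl
          map_rel' := fun r => isEmptyElim r })
      (fun _ _ h => hom_ext h) }

/-- An element of the hom-object `[A, B]`, as a homomorphism. -/
def toHom {A B : Variety.Alg.{u, u} V} (f : ihom A B) : A ⟶ B := f

/-- A homomorphism, as an element of the hom-object `[A, B]`. -/
def ofHom {A B : Variety.Alg.{u, u} V} (f : A ⟶ B) : ihom A B := f

/-- The transpose `A → [B, C]` of a bimorphism `A × B → C`. -/
def Bimorphism.curry {A : Variety.Alg.{u, v} V} {B C : Variety.Alg.{u, u} V}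
    (β : Bimorphism A B C) : A →[V.sig] ihom B C :=
  mkHom (B := ihom B C)
    (fun a => ofHom (A := B) (B := C) (mkHom (β.toFun a) (fun σ b => β.map_right σ a b)))
    (fun σ a => hom_ext (A := B) (B := C) (fun b => β.map_left σ a b))

/-- The evaluation bimorphism `X × [X, D] → D`. -/
def eval (X D : Variety.Alg.{u, u} V) : Bimorphism X (ihom X D) D where
  toFun x f := toHom f x
  map_left σ x f := hom_op (toHom f) σ x
  map_right _ _ _ := rfl

/-- The closed structure: transposition is a bijection between bimorphisms `A × B → C` (that is,
homomorphisms `A ⊗ B → C`) and homomorphisms `A → [B, C]`. -/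
def curryEquiv (A : Variety.Alg.{u, v} V) (B C : Variety.Alg.{u, u} V) :
    Bimorphism A B C ≃ (A →[V.sig] ihom B C) where
  toFun β := β.curry
  invFun g :=
    { toFun := fun a b => toHom (g a) b
      map_left := fun σ a b =>
        congrArg (fun f : ihom B C => toHom f b) (g.map_fun σ a)
      map_right := fun σ a b => hom_op (toHom (g a)) σ b }
  left_inv _ := rfl
  right_inv _ := rfl

/-- The composition `[A, B] × [B, C] → [A, C]` of the enrichment of the category of algebras
over itself. -/
def comp (A B C : Variety.Alg.{u, u} V) : Bimorphism (ihom A B) (ihom B C) (ihom A C) where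
  toFun f g := ofHom (toHom f ≫ toHom g)
  map_left σ f g := hom_ext (A := A) (B := C) fun a =>
    hom_op (toHom g) σ (fun i => toHom (f i) a)
  map_right _ _ _ := rfl

/-- The action `[B, C] → [[X, B], [X, C]]` on hom-objects of the enriched hom-functor `[X, -]`. -/
def homAct (X B C : Variety.Alg.{u, u} V) : ihom B C ⟶ ihom (ihom X B) (ihom X C) :=
  (comp X B C).flip.curry

/-- The homomorphism `[h, C] : [B, C] → [A, C]` given by precomposition with `h : A ⟶ B`. -/
def precompHom {A B : Variety.Alg.{u, u} V} (h : A ⟶ B) (C : Variety.Alg.{u, u} V) :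
    ihom B C ⟶ ihom A C :=
  toHom ((comp A B C).curry (ofHom h))

/-! ### Double dualization -/

/-- The contravariant functor `(-)* = [-, D]`. -/
def dual (D : Variety.Alg.{u, u} V) : (Variety.Alg.{u, u} V)ᵒᵖ ⥤ Variety.Alg.{u, u} V where
  obj X := ihom X.unop D
  map f := precompHom f.unop D
  map_id _ := rfl
  map_comp _ _ := rfl

/-- The functor `(-)**`. -/
def doubleDualFunctor (D : Variety.Alg.{u, u} V) :
    Variety.Alg.{u, u} V ⥤ Variety.Alg.{u, u} V :=
  (dual D).rightOp ⋙ dual D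

/-- The unit `X → X**` of double dualization: the transpose of the evaluation. -/
def evalUnit (D X : Variety.Alg.{u, u} V) : X ⟶ (doubleDualFunctor D).obj X :=
  (eval X D).curry

/-- The multiplication `X**** → X**` of double dualization: the dual of the unit at `X*`. -/
def evalMul (D X : Variety.Alg.{u, u} V) :
    (doubleDualFunctor D).obj ((doubleDualFunctor D).obj X) ⟶ (doubleDualFunctor D).obj X :=
  precompHom (evalUnit D (ihom X D)) D

/-- The double-dualization monad `(-)**`. -/
def doubleDual (D : Variety.Alg.{u, u} V) : Monad (Variety.Alg.{u, u} V) where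
  toFunctor := doubleDualFunctor D
  η := { app := fun X => evalUnit D X
         naturality := fun _ _ _ => rfl }
  μ := { app := fun X => evalMul D X
         naturality := fun _ _ _ => rfl }
  assoc _ := rfl
  left_unit _ := rfl
  right_unit _ := rfl

/-! ### Finitely presentable algebras and `*`-cogenerators -/

/-- The property of being a finitely presentable object of the category of algebras: the covariant
hom-functor preserves filtered colimits. -/
abbrev fp (V : Variety.{u}) : ObjectProperty (Variety.Alg.{u, u} V) :=
  ObjectProperty.isFinitelyPresentable.{u} (Variety.Alg.{u, u} V)

/-- For an algebra `X`, the diagram of all `A*`, indexed by the opposite of the category of all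
homomorphisms `a : X ⟶ A` with `A` finitely presentable. -/
def dualDiagram (D X : Variety.Alg.{u, u} V) :
    (StructuredArrow X (fp V).ι)ᵒᵖ ⥤ Variety.Alg.{u, u} V :=
  (StructuredArrow.proj X (fp V).ι ⋙ (fp V).ι).op ⋙ dual D

/-- The canonical cocone with the members `a* : A* ⟶ X*`. -/
def dualCocone (D X : Variety.Alg.{u, u} V) : Cocone (dualDiagram D X) where
  pt := ihom X D
  ι :=
    { app := fun a => precompHom a.unop.hom D
      naturality := by
        intro a b f
        have h := StructuredArrow.w f.unop
        exact congrArg (fun k => precompHom k D) h }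

/-- `D` is a `*`-object: every `X*` is the canonical colimit of all `A*` with `A` finitely
presentable. -/
def IsStarObject (D : Variety.Alg.{u, u} V) : Prop :=
  ∀ X : Variety.Alg.{u, u} V, Nonempty (IsColimit (dualCocone D X))

/-- `D` is a `*`-cogenerator: a cogenerator which is a `*`-object. -/
structure IsStarCogenerator (D : Variety.Alg.{u, u} V) : Prop where
  isCogenerator : IsCoseparator D
  isStarObject : IsStarObject D

/-! ### The `D`-ultrafilter monad -/

/-- The derived subobject of `a : X ⟶ A`: the preimage of (the image of) the unit `A → A**` under
`a** : X** → A**`. -/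
def derived (D : Variety.Alg.{u, u} V) {X A : Variety.Alg.{u, u} V} (a : X ⟶ A) :
    V.sig.Substructure ((doubleDualFunctor D).obj X) :=
  (FirstOrder.Language.Hom.range (evalUnit D A)).comap ((doubleDualFunctor D).map a)

/-- The intersection of the derived subobjects of all `a : X ⟶ A` with `A` finitely presentable.
Its elements are the `D`-ultrafilters on `X`. -/
def ultrafilters (D X : Variety.Alg.{u, u} V) :
    V.sig.Substructure ((doubleDualFunctor D).obj X) :=
  ⨅ a : StructuredArrow X (fp V).ι, derived D a.hom

theorem mem_ultrafilters {D X : Variety.Alg.{u, u} V} {x : (doubleDualFunctor D).obj X} :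
    x ∈ ultrafilters D X ↔ ∀ (A : Variety.Alg.{u, u} V), fp V A → ∀ a : X ⟶ A,
      ∃ t : A, evalUnit D A t = (doubleDualFunctor D).map a x := by
  unfold ultrafilters
  rw [FirstOrder.Language.Substructure.mem_iInf]
  constructor
  · intro h A hA a
    obtain ⟨t, ht⟩ := h (StructuredArrow.mk (Y := (⟨A, hA⟩ : (fp V).FullSubcategory)) a)
    exact ⟨t, ht⟩
  · intro h a
    obtain ⟨t, ht⟩ := h a.right.obj a.right.property a.hom
    exact ⟨t, ht⟩

/-- The algebra `TX` of all `D`-ultrafilters on `X`. -/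
def ultrafilterObj (D X : Variety.Alg.{u, u} V) : Variety.Alg.{u, u} V :=
  ofSub (ultrafilters D X)

/-- The inclusion `i : TX → X**`. -/
def ultrafilterIncl (D X : Variety.Alg.{u, u} V) :
    ultrafilterObj D X ⟶ (doubleDualFunctor D).obj X :=
  subIncl (ultrafilters D X)

theorem ultrafilterIncl_injective (D X : Variety.Alg.{u, u} V) :
    Function.Injective (ultrafilterIncl D X) := fun _ _ h => Subtype.ext h

/-- Factorization of a homomorphism into `X**` through `TX`. -/
def ultrafilterLift (D : Variety.Alg.{u, u} V) {X Y : Variety.Alg.{u, u} V}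
    (f : Y ⟶ (doubleDualFunctor D).obj X) (hf : ∀ y, f y ∈ ultrafilters D X) :
    Y ⟶ ultrafilterObj D X :=
  mkHom (B := ultrafilterObj D X) (fun y => (⟨f y, hf y⟩ : ultrafilters D X))
    (fun σ a => Subtype.ext (hom_op f σ a))

/-- The endofunctor `T`, the subfunctor of `(-)**` given by the `D`-ultrafilters. -/
def ultrafilterFunctor (D : Variety.Alg.{u, u} V) :
    Variety.Alg.{u, u} V ⥤ Variety.Alg.{u, u} V where
  obj X := ultrafilterObj D X
  map {X Y} f := ultrafilterLift D (ultrafilterIncl D X ≫ (doubleDualFunctor D).map f) (by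
    intro x
    rw [mem_ultrafilters]
    intro A hA a
    exact mem_ultrafilters.1 x.2 A hA (f ≫ a))
  map_id _ := rfl
  map_comp _ _ := rfl

/-- For a cogenerator `D`, the unit of double dualization is injective. -/
theorem evalUnit_injective {D : Variety.Alg.{u, u} V} (hD : IsCoseparator D)
    (A : Variety.Alg.{u, u} V) : Function.Injective (evalUnit D A) := by
  intro x y hxy
  let S : V.sig.Substructure (pi fun _ : ULift.{u} Bool => A) :=
    { carrier := {p | ∀ f : A ⟶ D, f (p ⟨true⟩) = f (p ⟨false⟩)}
      fun_mem := fun {n} σ p hp f => by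
        have h1 := hom_op f σ (fun i => p i ⟨true⟩)
        have h2 := hom_op f σ (fun i => p i ⟨false⟩)
        have h3 : (fun i => f (p i ⟨true⟩)) = fun i => f (p i ⟨false⟩) :=
          funext fun i => hp i f
        exact h1.trans ((congrArg (oper D σ) h3).trans h2.symm) }
  let p (b : Bool) : ofSub S ⟶ A :=
    subIncl S ≫ (proj (fun _ : ULift.{u} Bool => A) ⟨b⟩ : (pi fun _ : ULift.{u} Bool => A) ⟶ A)
  have hp : p true = p false := hD.def _ _ fun f => hom_ext fun q => q.2 f
  have hmem : (fun b => if b.down then x else y : ULift.{u} Bool → A) ∈ S := fun f =>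
    congrArg (fun g : (doubleDualFunctor D).obj A => toHom (A := ihom A D) (B := D) g (ofHom f)) hxy
  exact congrArg (fun g : ofSub S ⟶ A => g ⟨_, hmem⟩) hp

/-- The unit of double dualization takes its values in the `D`-ultrafilters. -/
theorem evalUnit_mem (D X : Variety.Alg.{u, u} V) (x : X) :
    evalUnit D X x ∈ ultrafilters D X :=
  mem_ultrafilters.2 fun _ _ a => ⟨a x, rfl⟩

/-- For a cogenerator `D`, the multiplication of double dualization restricts to the
`D`-ultrafilters. -/
theorem mul_mem {D : Variety.Alg.{u, u} V} (hD : IsCoseparator D) (X : Variety.Alg.{u, u} V)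
    (x : ultrafilterObj D (ultrafilterObj D X)) :
    evalMul D X ((doubleDualFunctor D).map (ultrafilterIncl D X)
      (ultrafilterIncl D (ultrafilterObj D X) x)) ∈ ultrafilters D X := by
  refine mem_ultrafilters.2 fun A hA a => ?_
  choose q hq using fun y : ultrafilterObj D X => mem_ultrafilters.1 y.2 A hA a
  have hinj := evalUnit_injective hD A
  let ψ : ultrafilterObj D X ⟶ A := mkHom q (fun σ y => hinj (by
    rw [hq, hom_op]
    have h1 := hom_op (ultrafilterIncl D X ≫ (doubleDualFunctor D).map a) σ y
    exact h1.trans (congrArg (oper _ σ) (funext fun i => (hq (y i)).symm))))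
  have hψ : ψ ≫ evalUnit D A = ultrafilterIncl D X ≫ (doubleDualFunctor D).map a :=
    hom_ext hq
  obtain ⟨t, ht⟩ := mem_ultrafilters.1 x.2 A hA ψ
  refine ⟨t, ht.trans ?_⟩
  have h2 := congrArg (fun k => evalMul D A ((doubleDualFunctor D).map k x.1)) hψ
  exact h2

/-- The `D`-ultrafilter monad: the endofunctor `T` of all `D`-ultrafilters, with unit and
multiplication restricted from `(-)**`. -/
def ultrafilterMonad (D : Variety.Alg.{u, u} V) (hD : IsCoseparator D) :
    Monad (Variety.Alg.{u, u} V) where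
  toFunctor := ultrafilterFunctor D
  η := { app := fun X => ultrafilterLift D (evalUnit D X) (evalUnit_mem D X)
         naturality := fun _ _ _ => rfl }
  μ := { app := fun X => ultrafilterLift D
          (ultrafilterIncl D (ultrafilterObj D X) ≫
            (doubleDualFunctor D).map (ultrafilterIncl D X) ≫ evalMul D X)
          (mul_mem hD X)
         naturality := fun _ _ _ => rfl }
  assoc _ := rfl
  left_unit _ := rfl
  right_unit _ := rfl

/-- The `D`-ultrafilter monad is a submonad of `(-)**`. -/
def ultrafilterMonadIncl (D : Variety.Alg.{u, u} V) (hD : IsCoseparator D) :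
    ultrafilterMonad D hD ⟶ doubleDual D where
  app X := ultrafilterIncl D X
  naturality _ _ _ := rfl
  app_η _ := rfl
  app_μ _ := rfl

/-! ### Enriched natural transformations and enriched codensity monads -/

section Enriched

variable (P : ObjectProperty (Variety.Alg.{u, u} V))

/-- The product of the algebras `[[X, A], [Z, A]]` over all `A` in the full subcategory `P`. (The
index set is a class, so the carrier lies in the next universe.) -/
def familyAlg (X Z : Variety.Alg.{u, u} V) : Variety.Alg.{u, u + 1} V :=
  pi fun A : P.FullSubcategory => ihom (ihom X A.obj) (ihom Z A.obj)

/-- The projections of the product `familyAlg`. -/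
def familyProj (X Z : Variety.Alg.{u, u} V) (A : P.FullSubcategory) :
    familyAlg P X Z →[V.sig] ihom (ihom X A.obj) (ihom Z A.obj) :=
  proj (fun A : P.FullSubcategory => ihom (ihom X A.obj) (ihom Z A.obj)) A

/-- The composite of `p_B ⊗ [Z, E-]` with the composition map
`[[X, B], [Z, B]] ⊗ [[Z, B], [Z, C]] → [[X, B], [Z, C]]`. -/
def uHat (X Z : Variety.Alg.{u, u} V) (B C : P.FullSubcategory) :
    Bimorphism (familyAlg P X Z) (ihom B.obj C.obj) (ihom (ihom X B.obj) (ihom Z C.obj)) :=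
  (comp (ihom X B.obj) (ihom Z B.obj) (ihom Z C.obj)).precomp
    (familyProj P X Z B) (homAct Z B.obj C.obj)

/-- The composite of the symmetry, of `[X, E-] ⊗ p_C` and of the composition map
`[[X, B], [X, C]] ⊗ [[X, C], [Z, C]] → [[X, B], [Z, C]]`. -/
def vHat (X Z : Variety.Alg.{u, u} V) (B C : P.FullSubcategory) :
    Bimorphism (familyAlg P X Z) (ihom B.obj C.obj) (ihom (ihom X B.obj) (ihom Z C.obj)) :=
  ((comp (ihom X B.obj) (ihom X C.obj) (ihom Z C.obj)).flip).precomp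
    (familyProj P X Z C) (homAct X B.obj C.obj)

/-- The joint equalizer of the transposes of `uHat B C` and `vHat B C`: the object `N(X, Z)` of enriched
natural transformations `[X, E-] → [Z, E-]`, where `E` is the embedding of the full subcategory
`P`. -/
def natSub (X Z : Variety.Alg.{u, u} V) : V.sig.Substructure (familyAlg P X Z) :=
  ⨅ (B : P.FullSubcategory) (C : P.FullSubcategory),
    FirstOrder.Language.Hom.eqLocus (uHat P X Z B C).curry (vHat P X Z B C).curry

/-- The algebra `N(X, Z)` of enriched natural transformations from `[X, E-]` to `[Z, E-]`. -/
def enrichedNat (X Z : Variety.Alg.{u, u} V) : Variety.Alg.{u, u + 1} V :=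
  ofSub (natSub P X Z)

/-- The component `[X, A] → [Z, A]` of an enriched natural transformation. -/
def natComponent {P : ObjectProperty (Variety.Alg.{u, u} V)}
    {X Z : Variety.Alg.{u, u} V} (τ : enrichedNat P X Z) (A : P.FullSubcategory) :
    ihom X A.obj ⟶ ihom Z A.obj :=
  toHom (familyProj P X Z A τ.1)

theorem mem_natSub {X Z : Variety.Alg.{u, u} V} {τ : familyAlg P X Z} :
    τ ∈ natSub P X Z ↔ ∀ (B C : P.FullSubcategory) (f : B.obj ⟶ C.obj),
      toHom (familyProj P X Z B τ) ≫ toHom (homAct Z B.obj C.obj (ofHom f)) =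
        toHom (homAct X B.obj C.obj (ofHom f)) ≫ toHom (familyProj P X Z C τ) := by
  unfold natSub
  simp only [FirstOrder.Language.Substructure.mem_iInf]
  constructor
  · intro h B C f
    exact congrArg (fun k => toHom (toHom k (ofHom f))) (h B C)
  · intro h B C
    exact hom_ext (A := ihom B.obj C.obj) (B := ihom (ihom X B.obj) (ihom Z C.obj))
      (fun f => h B C f)

/-- The contravariant action `N(X, h)` of `N(X, -)` on a homomorphism `h : Z' ⟶ Z`: the components
are composed with `[h, A]`. -/
def natMapRight {P : ObjectProperty (Variety.Alg.{u, u} V)}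
    {X Z Z' : Variety.Alg.{u, u} V} (h : Z' ⟶ Z) (τ : enrichedNat P X Z) :
    enrichedNat P X Z' :=
  (⟨fun A => natComponent τ A ≫ precompHom h A.obj, (mem_natSub P).2 fun B C f =>
    congrArg (fun k : ihom X B.obj ⟶ ihom Z C.obj => k ≫ precompHom h C.obj)
      ((mem_natSub P).1 τ.2 B C f)⟩ : natSub P X Z')

/-- The covariant action of `N(-, Z)` on a homomorphism `g : X ⟶ Y`: the components are
precomposed with `[g, A]`. -/
def natMapLeft {P : ObjectProperty (Variety.Alg.{u, u} V)}
    {X Y Z : Variety.Alg.{u, u} V} (g : X ⟶ Y) (τ : enrichedNat P X Z) :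
    enrichedNat P Y Z :=
  (⟨fun A => precompHom g A.obj ≫ natComponent τ A, (mem_natSub P).2 fun B C f =>
    congrArg (fun k : ihom X B.obj ⟶ ihom Z C.obj => precompHom g B.obj ≫ k)
      ((mem_natSub P).1 τ.2 B C f)⟩ : natSub P Y Z)

/-- The data exhibiting a monad `T` as the enriched codensity monad of the embedding `E` of the full
subcategory `P`, i.e. as the enriched right Kan extension of `E` along itself with its canonical
monad structure. -/
structure EnrichedCodensity (T : Monad (Variety.Alg.{u, u} V)) where
  /-- `T` is an enriched functor: its action on hom-objects is a homomorphism. -/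
  map_op : ∀ (X Y : Variety.Alg.{u, u} V) {n : ℕ} (σ : V.sig.Functions n)
    (f : Fin n → ihom X Y),
    ofHom (T.map (toHom (oper (ihom X Y) σ f))) =
      oper (ihom (T.obj X) (T.obj Y)) σ (fun i => ofHom (T.map (toHom (f i))))
  /-- the isomorphisms `[Z, TX] ≅ N(X, Z)` of algebras -/
  iso : ∀ X Z : Variety.Alg.{u, u} V, ihom Z (T.obj X) ≃[V.sig] enrichedNat P X Z
  /-- naturality in `Z` (as elements of hom-objects are homomorphisms and homomorphisms out of
  hom-objects are determined by their values, this equation is also the enriched naturality) -/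
  naturalRight : ∀ {X Z Z' : Variety.Alg.{u, u} V} (h : Z' ⟶ Z) (z : Z ⟶ T.obj X),
    iso X Z' (ofHom (h ≫ z)) = natMapRight h (iso X Z (ofHom z))
  /-- naturality in `X` -/
  naturalLeft : ∀ {X Y Z : Variety.Alg.{u, u} V} (g : X ⟶ Y) (z : Z ⟶ T.obj X),
    iso Y Z (ofHom (z ≫ T.map g)) = natMapLeft g (iso X Z (ofHom z))
  /-- the unit of `T` corresponds to the identity transformation of `[X, E-]`, that is,
  `ψ a ∘ η = a`, where `ψ a : TX ⟶ A` is the value at `a : X ⟶ A` of the transformation that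
  corresponds to the identity of `TX` -/
  unit : ∀ (X : Variety.Alg.{u, u} V) (A : P.FullSubcategory) (a : X ⟶ A.obj),
    natComponent (iso X X (ofHom (T.η.app X))) A (ofHom a) = ofHom a
  /-- the multiplication of `T` is the one of the codensity monad: `ψ a ∘ μ = ψ (ψ a)` -/
  mul : ∀ (X : Variety.Alg.{u, u} V) (A : P.FullSubcategory) (a : X ⟶ A.obj),
    natComponent (iso X (T.obj (T.obj X)) (ofHom (T.μ.app X))) A (ofHom a) =
      natComponent (iso (T.obj X) (T.obj (T.obj X)) (ofHom (𝟙 (T.obj (T.obj X))))) A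
        (natComponent (iso X (T.obj X) (ofHom (𝟙 (T.obj X)))) A (ofHom a))

/-- `T` is the enriched codensity monad of the embedding of the full subcategory `P`. -/
def IsEnrichedCodensityMonad (T : Monad (Variety.Alg.{u, u} V)) : Prop :=
  Nonempty (EnrichedCodensity P T)

end Enriched

end EntropicVariety

end

open EntropicVariety

noncomputable section

namespace EntropicVariety

variable {V : Variety.{u}} [V.IsCommutative] {D : Variety.Alg.{u, u} V}

/-! The point is that `TX` is the limit of the finitely presentable `A` over all `a : X ⟶ A`. As
`η_A` is injective, `a**` restricted to `TX` factors uniquely through `η_A`; the factor `ψ a` is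
`extend`. Dualizing the colimit of the `A*` exhibits `X**` as the limit of the `A**`, and `TX`
consists of the points whose components lie in the images of the `η_A`. So the `ψ a` are jointly
injective (`extend_jointly_injective`), and every compatible family of elements comes from a point
of `TX` (`exists_extend_eq`).

Hence homomorphisms `z : Z ⟶ TX` correspond to compatible families `a ↦ z ≫ ψ a`. These are exactly
the enriched natural transformations, because `a ↦ ψ a` preserves operations (`extend_oper`). The
unit, the multiplication and naturality in `X` are read off from `ψ a ≫ η_A = i ≫ a**`, where `i :
TX ⟶ X**` is the inclusion. -/

theorem exists_evalUnit_eq {X A : Variety.Alg.{u, u} V} (hA : fp V A) (a : X ⟶ A)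
    (x : ultrafilterObj D X) :
    ∃ t : A, evalUnit D A t = (doubleDualFunctor D).map a (ultrafilterIncl D X x) :=
  mem_ultrafilters.1 x.2 A hA a

/-- The homomorphism `ψ a : TX ⟶ A` through which `a**` factorizes on the `D`-ultrafilters. -/
def extend (hD : IsCoseparator D) {X A : Variety.Alg.{u, u} V} (hA : fp V A) (a : X ⟶ A) :
    ultrafilterObj D X ⟶ A :=
  -- Injectivity of `η_A` makes the chosen preimage unique, so operations are preserved because they
  -- are after applying `η_A`.
  mkHom (fun x => (exists_evalUnit_eq hA a x).choose) (fun σ x => evalUnit_injective hD A (by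
    have h := hom_op (ultrafilterIncl D X ≫ (doubleDualFunctor D).map a) σ x
    refine (exists_evalUnit_eq hA a _).choose_spec.trans (h.trans ?_)
    refine Eq.trans ?_ (hom_op (evalUnit D A) σ _).symm
    exact congrArg (oper _ σ)
      (funext fun i => (exists_evalUnit_eq hA a (x i)).choose_spec.symm)))

theorem evalUnit_extend (hD : IsCoseparator D) {X A : Variety.Alg.{u, u} V} (hA : fp V A)
    (a : X ⟶ A) (x : ultrafilterObj D X) :
    evalUnit D A (extend hD hA a x) = (doubleDualFunctor D).map a (ultrafilterIncl D X x) :=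
  (exists_evalUnit_eq hA a x).choose_spec

/-- Moves equations about `ψ a` into `A**`, where the left side is explicit and no choice is
involved. -/
theorem extend_eq_iff (hD : IsCoseparator D) {X A : Variety.Alg.{u, u} V} (hA : fp V A)
    (a : X ⟶ A) (x : ultrafilterObj D X) (t : A) :
    extend hD hA a x = t ↔
      (doubleDualFunctor D).map a (ultrafilterIncl D X x) = evalUnit D A t := by
  rw [← evalUnit_extend hD hA]
  exact (evalUnit_injective hD A).eq_iff.symm

/-- A `D`-ultrafilter `x`, applied to `a ≫ f`, is the value of `f` at `ψ a x`. -/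
theorem incl_comp_apply (hD : IsCoseparator D) {X A : Variety.Alg.{u, u} V} (hA : fp V A)
    (a : X ⟶ A) (x : ultrafilterObj D X) (f : A ⟶ D) :
    toHom (A := ihom X D) (B := D) (ultrafilterIncl D X x) (ofHom (a ≫ f)) =
      f (extend hD hA a x) :=
  congrArg (fun g : (doubleDualFunctor D).obj A => toHom (A := ihom A D) (B := D) g (ofHom f))
    (evalUnit_extend hD hA a x).symm

/-! ### Compatibility of `ψ` with operations, composition, unit and multiplication. -/

/-- A `D`-ultrafilter is itself a homomorphism `X* ⟶ D`, and composing with `f : A ⟶ D` turns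
pointwise operations of `[X, A]` into those of `X*`. This makes the components of `toNat` morphisms
of hom-objects. -/
theorem extend_oper (hD : IsCoseparator D) {X A : Variety.Alg.{u, u} V} (hA : fp V A) {n : ℕ}
    (σ : V.sig.Functions n) (a : Fin n → ihom X A) :
    extend hD hA (toHom (oper (ihom X A) σ a)) =
      toHom (oper (ihom (ultrafilterObj D X) A) σ
        (fun i => ofHom (extend hD hA (toHom (a i))))) := by
  refine hom_ext fun x => (extend_eq_iff hD hA _ x _).2 ?_
  refine hom_ext (A := ihom A D) (B := D) fun f => ?_
  have h1 : ofHom (toHom (oper (ihom X A) σ a) ≫ toHom f) =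
      oper (ihom X D) σ (fun i => ofHom (toHom (a i) ≫ toHom f)) :=
    hom_ext (A := X) (B := D) fun y => hom_op (toHom f) σ (fun i => toHom (a i) y)
  have h2 := hom_op (toHom (A := ihom X D) (B := D) (ultrafilterIncl D X x)) σ
    (fun i => ofHom (toHom (a i) ≫ toHom f))
  have h3 := hom_op (toHom f) σ (fun i => extend hD hA (toHom (a i)) x)
  refine (congrArg (toHom (A := ihom X D) (B := D) (ultrafilterIncl D X x)) h1).trans
    (h2.trans (Eq.trans ?_ h3.symm))
  exact congrArg (oper D σ) (funext fun i => incl_comp_apply hD hA (toHom (a i)) x (toHom f))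

theorem extend_comp (hD : IsCoseparator D) {X A B : Variety.Alg.{u, u} V} (hA : fp V A)
    (hB : fp V B) (a : X ⟶ A) (f : A ⟶ B) :
    extend hD hB (a ≫ f) = extend hD hA a ≫ f := by
  refine hom_ext fun x => (extend_eq_iff hD hB _ x _).2 ?_
  exact congrArg ((doubleDualFunctor D).map f) (evalUnit_extend hD hA a x).symm

theorem map_comp_extend (hD : IsCoseparator D) {X Y A : Variety.Alg.{u, u} V} (hA : fp V A)
    (g : X ⟶ Y) (a : Y ⟶ A) :
    (ultrafilterFunctor D).map g ≫ extend hD hA a = extend hD hA (g ≫ a) := by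
  refine hom_ext fun x => (extend_eq_iff hD hA a ((ultrafilterFunctor D).map g x) _).2 ?_
  exact (evalUnit_extend hD hA (g ≫ a) x).symm

theorem unit_comp_extend (hD : IsCoseparator D) {X A : Variety.Alg.{u, u} V} (hA : fp V A)
    (a : X ⟶ A) : (ultrafilterMonad D hD).η.app X ≫ extend hD hA a = a :=
  hom_ext fun x => (extend_eq_iff hD hA a ((ultrafilterMonad D hD).η.app X x) _).2 rfl

theorem mul_comp_extend (hD : IsCoseparator D) {X A : Variety.Alg.{u, u} V} (hA : fp V A)
    (a : X ⟶ A) :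
    (ultrafilterMonad D hD).μ.app X ≫ extend hD hA a = extend hD hA (extend hD hA a) := by
  refine hom_ext fun x => (extend_eq_iff hD hA a ((ultrafilterMonad D hD).μ.app X x) _).2 ?_
  refine Eq.trans ?_ (evalUnit_extend hD hA (extend hD hA a) x).symm
  have h : extend hD hA a ≫ evalUnit D A =
      ultrafilterIncl D X ≫ (doubleDualFunctor D).map a := hom_ext (evalUnit_extend hD hA a)
  -- Double-dualize `h` and apply the multiplication at `A`: a unit law leaves `(ψ a)**` on one
  -- side, naturality of the multiplication gives `a**` after `μ` on the other.
  exact congrArg (fun k => evalMul D A ((doubleDualFunctor D).map k x.1)) h.symm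

/-! ### `TX` as the limit of the finitely presentable algebras under `X`. -/

/-- For a `*`-object `D`, the homomorphisms `ψ a` are jointly injective. -/
theorem extend_jointly_injective (hD : IsStarCogenerator D) {X : Variety.Alg.{u, u} V}
    {x y : ultrafilterObj D X}
    (h : ∀ (A : Variety.Alg.{u, u} V) (hA : fp V A) (a : X ⟶ A),
      extend hD.isCogenerator hA a x = extend hD.isCogenerator hA a y) : x = y := by
  obtain ⟨hc⟩ := hD.isStarObject X
  -- As homomorphisms out of the colimit `X*`, `x` and `y` are determined by their restrictions
  -- along `a*`, which are evaluations at `ψ a x` and `ψ a y`.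
  refine ultrafilterIncl_injective D X (hc.hom_ext fun a => ?_)
  refine hom_ext (A := ihom a.unop.right.obj D) (B := D) fun f => ?_
  have hx := incl_comp_apply hD.isCogenerator a.unop.right.property a.unop.hom x (toHom f)
  have hy := incl_comp_apply hD.isCogenerator a.unop.right.property a.unop.hom y (toHom f)
  rw [h] at hx
  exact hx.trans hy.symm

/-- For a `*`-object `D`, every compatible choice of elements `t a : A` for all `a : X ⟶ A` is
induced by a `D`-ultrafilter. -/
theorem exists_extend_eq (hD : IsStarCogenerator D) {X : Variety.Alg.{u, u} V}
    (t : ∀ A : (fp V).FullSubcategory, (X ⟶ A.obj) → A.obj)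
    (ht : ∀ (A B : (fp V).FullSubcategory) (a : X ⟶ A.obj) (f : A.obj ⟶ B.obj),
      t B (a ≫ f) = f (t A a)) :
    ∃ x : ultrafilterObj D X, ∀ (A : (fp V).FullSubcategory) (a : X ⟶ A.obj),
      extend hD.isCogenerator A.property a x = t A a := by
  obtain ⟨hc⟩ := hD.isStarObject X
  -- Evaluations at the `t a` are homomorphisms `A* ⟶ D`; compatibility makes them a cocone, and the
  -- induced `X* ⟶ D` is the required element of `X**`.
  let s : Cocone (dualDiagram D X) :=
    { pt := D
      ι :=
        { app := fun a => evalUnit D a.unop.right.obj (t a.unop.right a.unop.hom)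
          naturality := fun a b f => hom_ext (A := ihom a.unop.right.obj D) (B := D) fun g => by
            have h := ht _ _ b.unop.hom ((fp V).ι.map f.unop.right)
            have hw : b.unop.hom ≫ (fp V).ι.map f.unop.right = a.unop.hom :=
              StructuredArrow.w f.unop
            exact congrArg (toHom g) (h.symm.trans (congrArg (t a.unop.right) hw)) } }
  have key (A : (fp V).FullSubcategory) (a : X ⟶ A.obj) :
      (doubleDualFunctor D).map a (ofHom (A := ihom X D) (B := D) (hc.desc s)) =
        evalUnit D A.obj (t A a) :=
    hc.fac s (op (StructuredArrow.mk (S := X) (T := (fp V).ι) (Y := A) a))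
  -- By `key`, the element `t a` witnesses membership in each derived subobject.
  refine ⟨⟨ofHom (A := ihom X D) (B := D) (hc.desc s),
    mem_ultrafilters.2 fun A hA a => ⟨_, (key ⟨A, hA⟩ a).symm⟩⟩, fun A a => ?_⟩
  exact (extend_eq_iff _ _ _ _ _).2 (key A a)

/-! ### The isomorphism between `[Z, TX]` and `N(X, Z)`. -/

/-- The enriched natural transformation `[X, E-] ⟶ [Z, E-]` with `a ↦ z ≫ ψ a`. -/
def toNat (hD : IsCoseparator D) {X Z : Variety.Alg.{u, u} V} (z : Z ⟶ ultrafilterObj D X) :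
    enrichedNat (fp V) X Z :=
  (⟨fun A => mkHom (A := ihom X A.obj) (B := ihom Z A.obj)
      (fun a => ofHom (z ≫ extend hD A.property (toHom a)))
      (fun σ a => congrArg (fun k => ofHom (z ≫ k)) (extend_oper hD A.property σ a)),
    (mem_natSub (fp V)).2 fun B C f =>
      hom_ext (A := ihom X B.obj) (B := ihom Z C.obj) fun a =>
        congrArg (fun k => ofHom (z ≫ k))
          (extend_comp hD B.property C.property (toHom a) f).symm⟩ : natSub (fp V) X Z)

@[ext] theorem enrichedNat_ext {P : ObjectProperty (Variety.Alg.{u, u} V)}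
    {X Z : Variety.Alg.{u, u} V} {τ τ' : enrichedNat P X Z}
    (h : ∀ (A : P.FullSubcategory) (a : X ⟶ A.obj),
      natComponent τ A (ofHom a) = natComponent τ' A (ofHom a)) : τ = τ' :=
  Subtype.ext (funext fun A => hom_ext (A := ihom X A.obj) (B := ihom Z A.obj) fun a => h A a)

/-- Evaluated at a point of `Z`, this is the compatibility that `exists_extend_eq` requires. -/
theorem natComponent_comp {P : ObjectProperty (Variety.Alg.{u, u} V)}
    {X Z : Variety.Alg.{u, u} V} (τ : enrichedNat P X Z) {A B : P.FullSubcategory}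
    (a : X ⟶ A.obj) (f : A.obj ⟶ B.obj) :
    natComponent τ B (ofHom (a ≫ f)) =
      ofHom (toHom (natComponent τ A (ofHom a)) ≫ f) :=
  congrArg (fun k : ihom X A.obj ⟶ ihom Z B.obj => k (ofHom a))
    ((mem_natSub P).1 τ.2 A B f).symm

theorem toNat_injective (hD : IsStarCogenerator D) {X Z : Variety.Alg.{u, u} V} :
    Function.Injective (toNat hD.isCogenerator : (Z ⟶ ultrafilterObj D X) → _) := by
  refine fun z z' h => hom_ext fun y => extend_jointly_injective hD fun A hA a => ?_
  exact congrArg (fun τ : enrichedNat (fp V) X Z =>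
    toHom (natComponent τ ⟨A, hA⟩ (ofHom a)) y) h

theorem toNat_surjective (hD : IsStarCogenerator D) {X Z : Variety.Alg.{u, u} V} :
    Function.Surjective (toNat hD.isCogenerator : (Z ⟶ ultrafilterObj D X) → _) := by
  intro τ
  -- The preimage is built pointwise: each `y` turns `τ` into a compatible family of elements.
  choose z hz using fun y : Z => exists_extend_eq hD
    (fun (A : (fp V).FullSubcategory) (a : X ⟶ A.obj) => toHom (natComponent τ A (ofHom a)) y)
    (fun A B a f => congrArg (fun k => toHom k y) (natComponent_comp τ a f))
  -- Preservation of operations by `z` is tested after each `ψ a`, where `z` becomes the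
  -- homomorphism `τ_A(a)`.
  refine ⟨mkHom z fun σ y => extend_jointly_injective hD fun A hA a => ?_, ?_⟩
  · rw [hz _ ⟨A, hA⟩ a, hom_op, hom_op]
    exact congrArg (oper A σ) (funext fun i => (hz (y i) ⟨A, hA⟩ a).symm)
  · exact enrichedNat_ext fun A a => hom_ext (A := Z) (B := A.obj) fun y => hz y A a

/-- The isomorphism `[Z, TX] ≅ N(X, Z)`. -/
def natEquiv (hD : IsStarCogenerator D) (X Z : Variety.Alg.{u, u} V) :
    ihom Z (ultrafilterObj D X) ≃[V.sig] enrichedNat (fp V) X Z where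
  toEquiv := Equiv.ofBijective _ ⟨toNat_injective hD, toNat_surjective hD⟩
  map_fun' σ z := enrichedNat_ext fun A a => hom_ext (A := Z) (B := A.obj) fun y =>
    hom_op (extend hD.isCogenerator A.property a) σ (fun i => toHom (z i) y)
  map_rel' r := isEmptyElim r

/-- The argument of `extend_oper` again, now tested on homomorphisms `g : Y ⟶ D` inside `Y**`. -/
theorem ultrafilterFunctor_map_oper (D X Y : Variety.Alg.{u, u} V) {n : ℕ}
    (σ : V.sig.Functions n) (f : Fin n → ihom X Y) :
    ofHom ((ultrafilterFunctor D).map (toHom (oper (ihom X Y) σ f))) =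
      oper (ihom (ultrafilterObj D X) (ultrafilterObj D Y)) σ
        (fun i => ofHom ((ultrafilterFunctor D).map (toHom (f i)))) := by
  refine hom_ext (A := ultrafilterObj D X) (B := ultrafilterObj D Y) fun x =>
    ultrafilterIncl_injective D Y (hom_ext (A := ihom Y D) (B := D) fun g => ?_)
  have h1 : ofHom (toHom (oper (ihom X Y) σ f) ≫ toHom g) =
      oper (ihom X D) σ (fun i => ofHom (toHom (f i) ≫ toHom g)) :=
    hom_ext (A := X) (B := D) fun y => hom_op (toHom g) σ (fun i => toHom (f i) y)
  exact (congrArg (toHom (A := ihom X D) (B := D) (ultrafilterIncl D X x)) h1).trans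
    (hom_op (toHom (A := ihom X D) (B := D) (ultrafilterIncl D X x)) σ _)

end EntropicVariety

end

theorem theoremT (V : Variety.{u}) [V.IsCommutative] (D : Variety.Alg.{u, u} V)
    (hD : IsStarCogenerator D) :
    IsEnrichedCodensityMonad (fp V) (ultrafilterMonad D hD.isCogenerator) :=
  ⟨{ map_op := fun X Y _ σ f => ultrafilterFunctor_map_oper D X Y σ f
     iso := natEquiv hD
     naturalRight := fun _ _ => rfl
     naturalLeft := fun g z => enrichedNat_ext fun A a =>
       congrArg (fun k => ofHom (z ≫ k)) (map_comp_extend hD.isCogenerator A.property g a)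
     unit := fun _ A a => unit_comp_extend hD.isCogenerator A.property a
     mul := fun _ A a => mul_comp_extend hD.isCogenerator A.property a }⟩
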